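/- A \emph{surface} is a compact orientable surface without boundary, with a fixed orientation. In a \emph{drawing} of a graph in a surface $\Sigma$, distinct vertices are represented by distinct points and each edge $uv$ by a Jordan arc joining the points that represent $u$ and $v$, so that no edge contains a vertex other than its endvertices, any two edges meet finitely many times, every intersection of two edges is a common endvertex or a crossing (not a tangency), and no three edges cross at a common point. The drawing is \emph{simple} if any two distinct edges are disjoint or have exactly one point in common. It \emph{realizes} a rotation system $\{\pi(v)\}_v$ if, for each vertex $v$, $\pi(v)$ is the cyclic permutation of the neighbours of $v$ that records the clockwise order in which the edges incident with $v$ leave $v$. For a positive integer $n$ let $L_n$ be the graph with vertex set $[n]\cup\{b,r\}$ in which any two distinct vertices are adjacent, except for $b$ and $r$, and let $\Pi_n$ be the rotation system $$\pi(b)=(n,\dots,2,1),\qquad \pi(r)=(1,2,\dots,n),\qquad \pi(i)=(b,1,2,\dots,i-1,i+1,\dots,n,r)\quad (i\in[n]).$$ For distinct $i,j\in[n]$ the \emph{canonical cycle} $C_{ij}$ is the $4$-cycle with edges $bi,\,bj,\,rj,\,ri$. For $\ell\in\{0,1,2\}$, an \emph{$\ell$-drawing} of $L_n$ in $\Sigma$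 is a simple drawing of $L_n$ in $\Sigma$ that realizes $\Pi_n$ and in which every canonical cycle has exactly $\ell$ self-crossings (crossings between two of its edges). \textbf{Proposition.} Let $\Sigma$ be a surface. Suppose that for each positive integer $m$ there is a simple drawing of $L_m$ in $\Sigma$ that realizes $\Pi_m$. Then for each positive integer $n$ there is an $\ell$-drawing of $L_n$ in $\Sigma$ for some $\ell\in\{0,1,2\}$. -/

import Mathlib

open Filter Topology

namespace SurfaceDrawing

/-! ### Compact oriented topological surfaces -/

/-- `f` preserves orientation at `z`: the image under `f` of every sufficiently small circle
around `z`, run through counterclockwise, winds exactly once counterclockwise around `f z`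
(`θ` is a continuous choice of the argument of `f - f z` along the circle). For a homeomorphism
between open subsets of the plane the winding number is always `1` or `-1`. -/
def PreservesOrientationAt (f : ℂ → ℂ) (z : ℂ) : Prop :=
  ∀ᶠ r in 𝓝[>] (0 : ℝ), ∃ θ : ℝ → ℝ, Continuous θ ∧
    (∀ t, f (circleMap z r t) = circleMap (f z) ‖f (circleMap z r t) - f z‖ (θ t)) ∧
    θ (2 * Real.pi) = θ 0 + 2 * Real.pi

/-- A compact oriented surface (without boundary): a compact Hausdorff space with an atlas of
charts to the plane all of whose transition maps preserve orientation. The orientation is the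
one for which the charts of the atlas are positively oriented. -/
class IsCompactOrientedSurface (S : Type*) [TopologicalSpace S] [ChartedSpace ℂ S] : Prop where
  t2 : T2Space S
  compact : CompactSpace S
  oriented : ∀ e ∈ atlas ℂ S, ∀ e' ∈ atlas ℂ S, ∀ p ∈ e.source ∩ e'.source,
    PreservesOrientationAt (fun z => e' (e.symm z)) (e p)

/-! ### Drawings of graphs -/

/-- The sets `A` and `B` (two arcs, in the applications) cross at `p`: some homeomorphism from an
open neighbourhood of `p` onto an open subset of the plane takes `p` to the origin, `A` to the
horizontal axis and `B` to the vertical axis. -/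
def CrossAt {S : Type*} [TopologicalSpace S] (A B : Set S) (p : S) : Prop :=
  ∃ h : OpenPartialHomeomorph S ℂ, p ∈ h.source ∧ h p = 0 ∧
    ∀ q ∈ h.source, (q ∈ A ↔ (h q).im = 0) ∧ (q ∈ B ↔ (h q).re = 0)

/-- A drawing of the graph `G` in `S`. The edge joining `u` and `v` is an injective path `arc`
from `vertex u` to `vertex v`; traversed from `v` to `u` it is the reversed path. -/
structure Drawing {V : Type*} (G : SimpleGraph V) (S : Type*) [TopologicalSpace S] where
  vertex : V → S
  arc : ∀ {u v : V}, G.Adj u v → Path (vertex u) (vertex v)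
  vertex_injective : Function.Injective vertex
  arc_injective : ∀ {u v : V} (h : G.Adj u v), Function.Injective (arc h)
  arc_symm : ∀ {u v : V} (h : G.Adj u v), arc h.symm = (arc h).symm
  /-- No edge contains a vertex other than its endvertices. -/
  vertex_mem_arc : ∀ {u v : V} (h : G.Adj u v) (w : V),
    vertex w ∈ Set.range (arc h) → w = u ∨ w = v
  /-- Every two edges intersect each other a finite number of times. -/
  finite_inter : ∀ {u v x y : V} (h : G.Adj u v) (h' : G.Adj x y), s(u, v) ≠ s(x, y) →
    (Set.range (arc h) ∩ Set.range (arc h')).Finite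
  /-- Every intersection of two edges is either a common endvertex or a crossing. -/
  inter_cases : ∀ {u v x y : V} (h : G.Adj u v) (h' : G.Adj x y), s(u, v) ≠ s(x, y) →
    ∀ p ∈ Set.range (arc h) ∩ Set.range (arc h'),
      (∃ w, w ∈ s(u, v) ∧ w ∈ s(x, y) ∧ p = vertex w) ∨
        CrossAt (Set.range (arc h)) (Set.range (arc h')) p
  /-- No three edges cross at a common point. -/
  no_triple : ∀ {u v x y z w : V} (h : G.Adj u v) (h' : G.Adj x y) (h'' : G.Adj z w),
    s(u, v) ≠ s(x, y) → s(u, v) ≠ s(z, w) → s(x, y) ≠ s(z, w) →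
    ∀ p, p ∈ Set.range (arc h) → p ∈ Set.range (arc h') → p ∈ Set.range (arc h'') →
      p ∈ Set.range vertex

/-- A rotation system on `V`: for each `v` a cyclic permutation of a subset of `V \ {v}`. -/
structure RotationSystem (V : Type*) where
  rot : V → Cycle V
  nodup : ∀ v, (rot v).Nodup
  notMem : ∀ v, v ∉ rot v

/-- Read in the chart `e`, the arc `γ` starting at `p` meets the circle of radius `r` around `p`
for the first time at the point of the circle with argument `θ`. -/
def FirstExit {S : Type*} [TopologicalSpace S] (e : OpenPartialHomeomorph S ℂ) {p q : S}
    (γ : Path p q) (r θ : ℝ) : Prop :=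
  ∃ t : unitInterval, (∀ s < t, γ s ∈ e.source ∧ ‖e (γ s) - e p‖ < r) ∧
    γ t ∈ e.source ∧ e (γ t) = circleMap (e p) r θ

namespace Drawing

variable {V : Type*} {G : SimpleGraph V} {S : Type*} [TopologicalSpace S]

/-- A simple drawing: any two edges are disjoint or have exactly one point in common. -/
def IsSimple (D : Drawing G S) : Prop :=
  ∀ {u v x y : V} (h : G.Adj u v) (h' : G.Adj x y), s(u, v) ≠ s(x, y) →
    (Set.range (D.arc h) ∩ Set.range (D.arc h')).Subsingleton

/-- The point `p` is a crossing of the two edges given by `h` and `h'`. -/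
def IsCrossing (D : Drawing G S) {u v x y : V} (h : G.Adj u v) (h' : G.Adj x y) (p : S) : Prop :=
  p ∉ Set.range D.vertex ∧ CrossAt (Set.range (D.arc h)) (Set.range (D.arc h')) p

/-- The self-crossings of a set `C` of edges: the crossings of two distinct edges of `C`. -/
def selfCrossings (D : Drawing G S) (C : Set (Sym2 V)) : Set S :=
  {p | ∃ (u v x y : V) (h : G.Adj u v) (h' : G.Adj x y),
    s(u, v) ∈ C ∧ s(x, y) ∈ C ∧ s(u, v) ≠ s(x, y) ∧ D.IsCrossing h h' p}

/-- The rotation at `v` is `c`: the entries of `c` are the neighbours of `v`, and the edges at `v`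
leave all sufficiently small circles around `v` (in a positively oriented chart) in the clockwise
cyclic order given by `c`. That is, for a list `w₁, …, wₖ` of the entries in the order of `c` the
arguments of the first exits satisfy `θ w₁ > θ w₂ > ⋯ > θ wₖ > θ w₁ - 2π`. -/
def HasRotationAt [ChartedSpace ℂ S] (D : Drawing G S) (v : V) (c : Cycle V) : Prop :=
  (∀ w, w ∈ c ↔ G.Adj v w) ∧
  ∀ᶠ r in 𝓝[>] (0 : ℝ), ∃ (l : List V) (θ : V → ℝ), (l : Cycle V) = c ∧
    (∀ {w : V} (h : G.Adj v w), FirstExit (chartAt ℂ (D.vertex v)) (D.arc h) r (θ w)) ∧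
    l.Pairwise (fun x y => θ y < θ x) ∧
    ∀ x ∈ l, ∀ y ∈ l, θ x - 2 * Real.pi < θ y

/-- The drawing realizes the rotation system `R`. -/
def Realizes [ChartedSpace ℂ S] (D : Drawing G S) (R : RotationSystem V) : Prop :=
  ∀ v, D.HasRotationAt v (R.rot v)

end Drawing

/-! ### The graphs `L_n`, the rotation systems `Π_n`, and `ℓ`-drawings -/

/-- The set `[n] ∪ {b, r}`; the elements of `[n]` are indexed by `Fin n`. -/
inductive LVertex (n : ℕ) : Type
  | b : LVertex n
  | r : LVertex n
  | num (i : Fin n) : LVertex n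

/-- The graph `L_n` on `[n] ∪ {b, r}`: all pairs except `{b, r}` are adjacent. -/
def graphL (n : ℕ) : SimpleGraph (LVertex n) where
  Adj u v := u ≠ v ∧ s(u, v) ≠ s(LVertex.b, LVertex.r)
  symm := ⟨fun u v h => ⟨h.1.symm, by rw [Sym2.eq_swap]; exact h.2⟩⟩
  loopless := ⟨fun _ h => h.1 rfl⟩

/-- The lists of the rotations of `Π_n`: `b : (n, …, 2, 1)`, `r : (1, 2, …, n)` and
`i : (b, 1, …, i - 1, i + 1, …, n, r)`. -/
def rotList (n : ℕ) : LVertex n → List (LVertex n)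
  | .b => (List.finRange n).reverse.map LVertex.num
  | .r => (List.finRange n).map LVertex.num
  | .num i => LVertex.b :: (((List.finRange n).filter (fun j => j ≠ i)).map LVertex.num
      ++ [LVertex.r])

theorem num_injective (n : ℕ) : Function.Injective (LVertex.num : Fin n → LVertex n) :=
  fun _ _ h => LVertex.num.inj h

/-- The rotation system `Π_n`. -/
def rotPi (n : ℕ) : RotationSystem (LVertex n) where
  rot v := (rotList n v : Cycle (LVertex n))
  nodup v := by
    rw [Cycle.nodup_coe_iff]
    cases v with
    | b => exact (List.nodup_reverse.2 (List.nodup_finRange n)).map (num_injective n)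
    | r => exact (List.nodup_finRange n).map (num_injective n)
    | num i =>
      have h := ((List.nodup_finRange n).filter (fun j => j ≠ i)).map (num_injective n)
      simp only [rotList, List.nodup_cons, List.nodup_append]
      refine ⟨by simp, h, by simp, by simp⟩
  notMem v := by
    rw [Cycle.mem_coe_iff]
    cases v <;> simp [rotList]

/-- The edges `bi, bj, rj, ri` of the canonical cycle `C_{ij}`. -/
def canonicalCycle {n : ℕ} (i j : Fin n) : Set (Sym2 (LVertex n)) :=
  {s(.b, .num i), s(.b, .num j), s(.r, .num j), s(.r, .num i)}

/-- An `ℓ`-drawing of `L_n`: a simple drawing that realizes `Π_n` and in which every canonical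
cycle has exactly `ℓ` self-crossings. -/
def IsEllDrawing {S : Type*} [TopologicalSpace S] [ChartedSpace ℂ S] {n : ℕ} (ℓ : ℕ)
    (D : Drawing (graphL n) S) : Prop :=
  D.IsSimple ∧ D.Realizes (rotPi n) ∧
    ∀ i j : Fin n, i ≠ j → (D.selfCrossings (canonicalCycle i j)).encard = ℓ

end SurfaceDrawing

/-!
In a simple drawing adjacent edges do not cross, so in a canonical cycle only the two pairs of
opposite edges `bi, rj` and `bj, ri` can cross, each at most once. Hence every canonical cycle has
`0`, `1` or `2` self-crossings (`Drawing.IsSimple.encard_selfCrossings_canonicalCycle_le`). This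
colours the pairs `i < j` in `[m]` with three colours, and Ramsey's theorem for pairs
(`exists_monochromatic_orderEmbedding`) gives, for `m` large, `n` indices all of whose pairs have
the same colour `ℓ`.

Delete the other indices and relabel the remaining ones in increasing order. This keeps the drawing
simple, it keeps the crossings of the surviving edges (`Drawing.selfCrossings_comap`), and it turns
`Π_m` into `Π_n`: the rotation at a surviving vertex is obtained by deleting the other entries
(`Drawing.HasRotationAt.comap`, `filterMap_partialInv_rotList`).
-/

/-! ### Ramsey's theorem for pairs -/

/-- Given `k`, every colouring of the pairs of a large enough linear order admits a set of `k`
elements on which the colour of a pair `x < y` depends on `x` only. The set is built greedily: take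
the least element `a`, then pass to the most popular colour class of the pairs `(a, y)`. -/
theorem exists_finset_color_eq_of_lt (κ : Type) [Fintype κ] [DecidableEq κ] (k : ℕ) :
    ∃ N : ℕ, ∀ (α : Type) [LinearOrder α] (s : Finset α) (c : α → α → κ), N ≤ s.card →
      ∃ t ⊆ s, t.card = k ∧ ∃ d : α → κ, ∀ x ∈ t, ∀ y ∈ t, x < y → c x y = d x := by
  induction k with
  | zero => exact ⟨0, fun α _ s c _ => ⟨∅, by simp, rfl, fun x => c x x, by simp⟩⟩
  | succ k ih =>
    obtain ⟨N, hN⟩ := ih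
    refine ⟨Fintype.card κ * N + 1, fun α _ s c hs => ?_⟩
    have hne : s.Nonempty := Finset.card_pos.1 (by omega)
    have ha : s.min' hne ∈ s := s.min'_mem hne
    set a := s.min' hne
    obtain ⟨col, -, hcol⟩ := Finset.exists_le_card_fiber_of_mul_le_card_of_maps_to
      (s := s.erase a) (t := Finset.univ) (f := c a) (n := N) (fun _ _ => Finset.mem_univ _)
      ⟨c a a, Finset.mem_univ _⟩ (by rw [Finset.card_univ, Finset.card_erase_of_mem ha]; omega)
    obtain ⟨t, hts, htk, d, hd⟩ := hN α _ c hcol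
    have hmem : ∀ y ∈ t, a < y ∧ y ∈ s ∧ c a y = col := fun y hy => by
      have h := hts hy
      rw [Finset.mem_filter, Finset.mem_erase] at h
      exact ⟨lt_of_le_of_ne (s.min'_le y h.1.2) (Ne.symm h.1.1), h.1.2, h.2⟩
    refine ⟨insert a t, ?_, ?_, Function.update d a col, ?_⟩
    · exact Finset.insert_subset ha fun y hy => (hmem y hy).2.1
    · rw [Finset.card_insert_of_notMem fun h => lt_irrefl a (hmem a h).1, htk]
    · intro x hx y hy hxy
      rcases Finset.mem_insert.1 hx with rfl | hx
      · rcases Finset.mem_insert.1 hy with rfl | hy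
        · exact absurd hxy (lt_irrefl _)
        · rw [Function.update_self, (hmem y hy).2.2]
      · rcases Finset.mem_insert.1 hy with rfl | hy
        · exact absurd hxy (hmem x hx).1.not_gt
        · rw [Function.update_of_ne (hmem x hx).1.ne', hd x hx y hy hxy]

/-- Ramsey's theorem for pairs and finitely many colours, with the monochromatic set enumerated in
increasing order. -/
theorem exists_monochromatic_orderEmbedding (κ : Type) [Fintype κ] [DecidableEq κ] [Nonempty κ]
    (n : ℕ) : ∃ N : ℕ, ∀ m, N ≤ m → ∀ c : Fin m → Fin m → κ,
      ∃ (f : Fin n ↪o Fin m) (col : κ), ∀ i j, i < j → c (f i) (f j) = col := by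
  obtain ⟨N, hN⟩ := exists_finset_color_eq_of_lt κ (Fintype.card κ * n)
  refine ⟨N, fun m hm c => ?_⟩
  obtain ⟨t, -, htk, d, hd⟩ := hN (Fin m) Finset.univ c (by simpa using hm)
  obtain ⟨col, -, hcol⟩ := Finset.exists_le_card_fiber_of_mul_le_card_of_maps_to
    (s := t) (t := Finset.univ) (f := d) (n := n) (fun _ _ => Finset.mem_univ _)
    Finset.univ_nonempty (by rw [Finset.card_univ, htk])
  obtain ⟨u, hu, hun⟩ := Finset.exists_subset_card_eq hcol
  have hmem : ∀ i, u.orderEmbOfFin hun i ∈ t ∧ d (u.orderEmbOfFin hun i) = col := fun i =>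
    Finset.mem_filter.1 (hu (u.orderEmbOfFin_mem hun i))
  exact ⟨u.orderEmbOfFin hun, col, fun i j hij => by
    rw [hd _ (hmem i).1 _ (hmem j).1 ((u.orderEmbOfFin hun).lt_iff_lt.2 hij), (hmem i).2]⟩

namespace SurfaceDrawing

/-! ### Crossings in simple drawings -/

theorem CrossAt.mem {S : Type*} [TopologicalSpace S] {A B : Set S} {p : S} (h : CrossAt A B p) :
    p ∈ A ∧ p ∈ B := by
  obtain ⟨e, hp, h0, he⟩ := h
  exact ⟨(he p hp).1.2 (by simp [h0]), (he p hp).2.2 (by simp [h0])⟩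

namespace Drawing

variable {V W : Type*} {G : SimpleGraph V} {H : SimpleGraph W} {S : Type*} [TopologicalSpace S]

theorem vertex_left_mem_range_arc (D : Drawing G S) {u v : V} (h : G.Adj u v) :
    D.vertex u ∈ Set.range (D.arc h) := ⟨0, (D.arc h).source⟩

theorem vertex_right_mem_range_arc (D : Drawing G S) {u v : V} (h : G.Adj u v) :
    D.vertex v ∈ Set.range (D.arc h) := ⟨1, (D.arc h).target⟩

theorem vertex_mem_range_arc (D : Drawing G S) {u v w : V} (h : G.Adj u v) (hw : w ∈ s(u, v)) :
    D.vertex w ∈ Set.range (D.arc h) := by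
  rcases Sym2.mem_iff.1 hw with rfl | rfl
  · exact D.vertex_left_mem_range_arc h
  · exact D.vertex_right_mem_range_arc h

/-- The point set of an edge does not depend on the direction in which the edge is traversed. -/
theorem range_arc_congr (D : Drawing G S) {u v x y : V} (h : G.Adj u v) (h' : G.Adj x y)
    (e : s(u, v) = s(x, y)) : Set.range (D.arc h) = Set.range (D.arc h') := by
  rcases Sym2.eq_iff.1 e with ⟨rfl, rfl⟩ | ⟨rfl, rfl⟩
  · rfl
  · rw [D.arc_symm h', Path.symm_range]

theorem IsSimple.not_isCrossing_of_mem {D : Drawing G S} (hD : D.IsSimple) {u v x y w : V}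
    {h : G.Adj u v} {h' : G.Adj x y} (hne : s(u, v) ≠ s(x, y)) (hw : w ∈ s(u, v))
    (hw' : w ∈ s(x, y)) (p : S) : ¬ D.IsCrossing h h' p := fun hp =>
  hp.1 ⟨w, hD h h' hne ⟨D.vertex_mem_range_arc h hw, D.vertex_mem_range_arc h' hw'⟩ hp.2.mem⟩

end Drawing

theorem adj_b_num {n : ℕ} (i : Fin n) : (graphL n).Adj .b (.num i) :=
  ⟨nofun, by simp⟩

theorem adj_r_num {n : ℕ} (i : Fin n) : (graphL n).Adj .r (.num i) :=
  ⟨nofun, by simp⟩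

theorem canonicalCycle_comm {n : ℕ} (i j : Fin n) : canonicalCycle i j = canonicalCycle j i := by
  ext e
  simp only [canonicalCycle, Set.mem_insert_iff, Set.mem_singleton_iff]
  tauto

/-- Only the two pairs of opposite edges of a canonical cycle can cross in a simple drawing. -/
theorem Drawing.IsSimple.selfCrossings_canonicalCycle_subset {S : Type*} [TopologicalSpace S]
    {n : ℕ} {D : Drawing (graphL n) S} (hD : D.IsSimple) (i j : Fin n) :
    D.selfCrossings (canonicalCycle i j) ⊆
      (Set.range (D.arc (adj_b_num i)) ∩ Set.range (D.arc (adj_r_num j))) ∪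
        (Set.range (D.arc (adj_b_num j)) ∩ Set.range (D.arc (adj_r_num i))) := by
  rintro p ⟨u, v, x, y, h, h', hC, hC', hne, hp⟩
  have no : ∀ w, w ∈ s(u, v) → w ∈ s(x, y) → False := fun w hw hw' =>
    hD.not_isCrossing_of_mem hne hw hw' p hp
  obtain ⟨hm, hm'⟩ := hp.2.mem
  have key : ∀ {z w : LVertex n} (hzw : (graphL n).Adj z w), s(u, v) = s(z, w) →
      p ∈ Set.range (D.arc hzw) := fun hzw e => D.range_arc_congr h hzw e ▸ hm
  have key' : ∀ {z w : LVertex n} (hzw : (graphL n).Adj z w), s(x, y) = s(z, w) →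
      p ∈ Set.range (D.arc hzw) := fun hzw e => D.range_arc_congr h' hzw e ▸ hm'
  simp only [canonicalCycle, Set.mem_insert_iff, Set.mem_singleton_iff] at hC hC'
  rcases hC with e | e | e | e <;> rcases hC' with e' | e' | e' | e'
  · exact absurd (e.trans e'.symm) hne
  · exact (no .b (by simp [e]) (by simp [e'])).elim
  · exact .inl ⟨key _ e, key' _ e'⟩
  · exact (no (.num i) (by simp [e]) (by simp [e'])).elim
  · exact (no .b (by simp [e]) (by simp [e'])).elim
  · exact absurd (e.trans e'.symm) hne
  · exact (no (.num j) (by simp [e]) (by simp [e'])).elim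
  · exact .inr ⟨key _ e, key' _ e'⟩
  · exact .inl ⟨key' _ e', key _ e⟩
  · exact (no (.num j) (by simp [e]) (by simp [e'])).elim
  · exact absurd (e.trans e'.symm) hne
  · exact (no .r (by simp [e]) (by simp [e'])).elim
  · exact (no (.num i) (by simp [e]) (by simp [e'])).elim
  · exact .inr ⟨key' _ e', key _ e⟩
  · exact (no .r (by simp [e]) (by simp [e'])).elim
  · exact absurd (e.trans e'.symm) hne

theorem Drawing.IsSimple.encard_selfCrossings_canonicalCycle_le {S : Type*} [TopologicalSpace S]
    {n : ℕ} {D : Drawing (graphL n) S} (hD : D.IsSimple) {i j : Fin n} (hij : i ≠ j) :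
    (D.selfCrossings (canonicalCycle i j)).encard ≤ 2 := by
  have key : ∀ a b : Fin n, a ≠ b →
      (Set.range (D.arc (adj_b_num a)) ∩ Set.range (D.arc (adj_r_num b))).encard ≤ 1 :=
    fun a b hab => Set.encard_le_one_iff_subsingleton.2 (hD _ _ (by simp [hab]))
  calc _ ≤ _ := Set.encard_le_encard (hD.selfCrossings_canonicalCycle_subset i j)
    _ ≤ _ := Set.encard_union_le _ _
    _ ≤ 1 + 1 := add_le_add (key i j hij) (key j i hij.symm)
    _ = 2 := one_add_one_eq_two

/-! ### Restriction to an induced subgraph -/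

namespace Drawing

variable {V W : Type*} {G : SimpleGraph V} {H : SimpleGraph W} {S : Type*} [TopologicalSpace S]

theorem mk_map_ne (φ : H ↪g G) {u v x y : W} (h : s(u, v) ≠ s(x, y)) :
    s(φ u, φ v) ≠ s(φ x, φ y) := fun e =>
  h (Sym2.map.injective φ.injective (by simpa using e))

/-- The drawing of an induced subgraph `H` of `G` (up to the relabelling `φ`) obtained from a
drawing of `G` by deleting the other vertices and edges. -/
def comap (D : Drawing G S) (φ : H ↪g G) : Drawing H S where
  vertex w := D.vertex (φ w)
  arc h := D.arc (φ.map_rel_iff.2 h)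
  vertex_injective := D.vertex_injective.comp φ.injective
  arc_injective h := D.arc_injective _
  arc_symm h := D.arc_symm (φ.map_rel_iff.2 h)
  vertex_mem_arc h w hw := by
    simpa only [φ.injective.eq_iff] using D.vertex_mem_arc (φ.map_rel_iff.2 h) (φ w) hw
  finite_inter h h' hne := D.finite_inter _ _ (mk_map_ne φ hne)
  inter_cases {u v x y} h h' hne p hp := by
    refine (D.inter_cases (φ.map_rel_iff.2 h) (φ.map_rel_iff.2 h') (mk_map_ne φ hne) p hp).imp_left
      ?_
    rintro ⟨w, hw, hw', rfl⟩
    rw [← Sym2.map_mk, Sym2.mem_map] at hw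
    obtain ⟨a, ha, rfl⟩ := hw
    rw [← Sym2.map_mk, Sym2.mem_map] at hw'
    obtain ⟨b, hb, hab⟩ := hw'
    exact ⟨a, ha, φ.injective hab ▸ hb, rfl⟩
  no_triple {u v x y z w} h h' h'' h₁ h₂ h₃ p hp hp' hp'' := by
    obtain ⟨a, rfl⟩ := D.no_triple (φ.map_rel_iff.2 h) (φ.map_rel_iff.2 h') (φ.map_rel_iff.2 h'')
      (mk_map_ne φ h₁) (mk_map_ne φ h₂) (mk_map_ne φ h₃) p hp hp' hp''
    -- A vertex on a surviving edge is an end of it, hence survives.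
    rcases D.vertex_mem_arc _ a hp with rfl | rfl
    · exact ⟨u, rfl⟩
    · exact ⟨v, rfl⟩

theorem IsSimple.comap {D : Drawing G S} (hD : D.IsSimple) (φ : H ↪g G) : (D.comap φ).IsSimple :=
  fun _ _ hne => hD _ _ (mk_map_ne φ hne)

theorem isCrossing_comap (D : Drawing G S) (φ : H ↪g G) {u v x y : W} (h : H.Adj u v)
    (h' : H.Adj x y) (p : S) : (D.comap φ).IsCrossing h h' p ↔
      D.IsCrossing (φ.map_rel_iff.2 h) (φ.map_rel_iff.2 h') p := by
  refine and_congr_left fun hp => not_congr ⟨fun ⟨w, hw⟩ => ⟨φ w, hw⟩, ?_⟩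
  rintro ⟨a, rfl⟩
  rcases D.vertex_mem_arc (φ.map_rel_iff.2 h) a hp.mem.1 with rfl | rfl
  · exact ⟨u, rfl⟩
  · exact ⟨v, rfl⟩

theorem exists_eq_of_mk_mem_image_map {f : W → V} {C : Set (Sym2 W)} {u v : V}
    (h : s(u, v) ∈ Sym2.map f '' C) : ∃ a b, s(a, b) ∈ C ∧ f a = u ∧ f b = v := by
  obtain ⟨e, he, heq⟩ := h
  induction e with
  | _ a b =>
    rcases Sym2.eq_iff.1 ((Sym2.map_mk ..).symm.trans heq) with ⟨h₁, h₂⟩ | ⟨h₁, h₂⟩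
    · exact ⟨a, b, he, h₁, h₂⟩
    · exact ⟨b, a, Sym2.eq_swap ▸ he, h₂, h₁⟩

theorem selfCrossings_comap (D : Drawing G S) (φ : H ↪g G) (C : Set (Sym2 W)) :
    (D.comap φ).selfCrossings C = D.selfCrossings (Sym2.map φ '' C) := by
  ext p
  constructor
  · rintro ⟨u, v, x, y, h, h', hC, hC', hne, hp⟩
    exact ⟨φ u, φ v, φ x, φ y, φ.map_rel_iff.2 h, φ.map_rel_iff.2 h', ⟨_, hC, Sym2.map_mk ..⟩,
      ⟨_, hC', Sym2.map_mk ..⟩, mk_map_ne φ hne, (D.isCrossing_comap φ h h' p).1 hp⟩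
  · rintro ⟨u, v, x, y, h, h', hC, hC', hne, hp⟩
    obtain ⟨u, v, hC₁, rfl, rfl⟩ := exists_eq_of_mk_mem_image_map hC
    obtain ⟨x, y, hC₁', rfl, rfl⟩ := exists_eq_of_mk_mem_image_map hC'
    exact ⟨u, v, x, y, φ.map_rel_iff.1 h, φ.map_rel_iff.1 h', hC₁, hC₁',
      fun e => hne (by rw [← Sym2.map_mk, ← Sym2.map_mk, e]),
      (D.isCrossing_comap φ _ _ p).2 hp⟩

end Drawing

theorem _root_.List.IsRotated.filterMap {α β : Type*} {l l' : List α} (h : l ~r l')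
    (g : α → Option β) : l.filterMap g ~r l'.filterMap g := by
  obtain ⟨k, hk, rfl⟩ := List.isRotated_iff_mod.1 h
  rw [List.rotate_eq_drop_append_take hk]
  conv_lhs => rw [← List.take_append_drop k l]
  rw [List.filterMap_append, List.filterMap_append]
  exact List.isRotated_append

/-- The rotation of a surviving vertex in the restricted drawing arises by deleting from the
original rotation the entries outside the range of `φ`. -/
theorem Drawing.HasRotationAt.comap {V W : Type*} {G : SimpleGraph V} {H : SimpleGraph W}
    {S : Type*} [TopologicalSpace S] [ChartedSpace ℂ S] {D : Drawing G S} {φ : H ↪g G} {w : W}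
    {l : List V} (h : D.HasRotationAt (φ w) l) :
    (D.comap φ).HasRotationAt w (l.filterMap (Function.partialInv φ) : List W) := by
  have hinv : ∀ x y, Function.partialInv φ y = some x ↔ φ x = y := φ.injective.isPartialInv
  refine ⟨fun x => ?_, ?_⟩
  · rw [Cycle.mem_coe_iff, List.mem_filterMap]
    simp only [hinv, exists_eq_right']
    rw [← Cycle.mem_coe_iff, h.1, φ.map_rel_iff]
  · filter_upwards [h.2] with r hr
    obtain ⟨l', θ, hl', hexit, hpair, hwidth⟩ := hr
    refine ⟨l'.filterMap (Function.partialInv φ), fun x => θ (φ x), ?_, ?_, ?_, ?_⟩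
    · exact Cycle.coe_eq_coe.2 ((Cycle.coe_eq_coe.1 hl').filterMap _)
    · exact fun hx => hexit (φ.map_rel_iff.2 hx)
    · refine hpair.filterMap _ fun a a' haa' b hb b' hb' => ?_
      rw [hinv] at hb hb'
      subst hb hb'
      exact haa'
    · simp only [List.mem_filterMap, hinv, exists_eq_right']
      exact fun x hx y hy => hwidth _ hx _ hy

/-! ### Induced copies of `L_n` in `L_m` -/

/-- The embedding of `L_n` into `L_m` that fixes `b` and `r` and maps the index `i` to `f i`. -/
def graphLEmbedding {n m : ℕ} (f : Fin n ↪o Fin m) : graphL n ↪g graphL m where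
  toFun
    | .b => .b
    | .r => .r
    | .num i => .num (f i)
  inj' u v h := by cases u <;> cases v <;> simp_all
  map_rel_iff' {u v} := by 
    change (_ ≠ _ ∧ _) ↔ (_ ≠ _ ∧ _)
    cases u <;> cases v <;> simp <;> exact ⟨rfl, rfl⟩

@[simp] theorem graphLEmbedding_b {n m : ℕ} (f : Fin n ↪o Fin m) :
    graphLEmbedding f .b = .b := rfl

@[simp] theorem graphLEmbedding_r {n m : ℕ} (f : Fin n ↪o Fin m) :
    graphLEmbedding f .r = .r := rfl

@[simp] theorem graphLEmbedding_num {n m : ℕ} (f : Fin n ↪o Fin m) (i : Fin n) :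
    graphLEmbedding f (.num i) = .num (f i) := rfl

theorem image_map_canonicalCycle {n m : ℕ} (f : Fin n ↪o Fin m) (i j : Fin n) :
    Sym2.map (graphLEmbedding f) '' canonicalCycle i j = canonicalCycle (f i) (f j) := by
  simp [canonicalCycle, Set.image_insert_eq]

theorem filterMap_partialInv_finRange {n m : ℕ} (f : Fin n ↪o Fin m) :
    (List.finRange m).filterMap (Function.partialInv f) = List.finRange n := by
  have hinv : ∀ x y, Function.partialInv f y = some x ↔ f x = y := f.injective.isPartialInv
  have hs : ((List.finRange m).filterMap (Function.partialInv f)).Pairwise (· < ·) := by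
    refine (List.pairwise_lt_finRange m).filterMap _ fun a a' haa' b hb b' hb' => ?_
    rw [hinv] at hb hb'
    rwa [← f.lt_iff_lt, hb, hb']
  refine List.Perm.eq_of_pairwise' hs (List.pairwise_lt_finRange n) ?_
  exact (List.perm_ext_iff_of_nodup (hs.imp ne_of_lt) (List.nodup_finRange n)).2
    (by simp [List.mem_filterMap, hinv])

theorem partialInv_graphLEmbedding_num {n m : ℕ} (f : Fin n ↪o Fin m) (j : Fin m) :
    Function.partialInv (graphLEmbedding f) (.num j) = (Function.partialInv f j).map .num := by
  have hinv : ∀ x y, Function.partialInv (graphLEmbedding f) y = some x ↔ graphLEmbedding f x = y :=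
    (graphLEmbedding f).injective.isPartialInv
  have hinv' : ∀ x y, Function.partialInv f y = some x ↔ f x = y := f.injective.isPartialInv
  ext x
  rw [hinv, Option.map_eq_some_iff]
  cases x <;> simp [hinv']

theorem filterMap_partialInv_map_num {n m : ℕ} (f : Fin n ↪o Fin m) (l : List (Fin m)) :
    (l.map LVertex.num).filterMap (Function.partialInv (graphLEmbedding f)) =
      (l.filterMap (Function.partialInv f)).map LVertex.num := by
  rw [List.filterMap_map, List.map_filterMap]
  congr 1
  exact funext fun j => partialInv_graphLEmbedding_num f j

theorem filterMap_partialInv_filter_ne {n m : ℕ} (f : Fin n ↪o Fin m) (i : Fin n)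
    (l : List (Fin m)) : (l.filter (fun j => j ≠ f i)).filterMap (Function.partialInv f) =
      (l.filterMap (Function.partialInv f)).filter (fun j => j ≠ i) := by
  have hinv : ∀ x y, Function.partialInv f y = some x ↔ f x = y := f.injective.isPartialInv
  rw [List.filterMap_filter, List.filter_filterMap]
  congr 1
  funext j
  ext x
  by_cases hj : j = f i
  · subst hj
    simp [Function.partialInv_left f.injective]
    exact Eq.symm
  · simp only [ne_eq, hj, not_false_eq_true, decide_true, if_true, hinv, Option.filter_eq_some_iff]
    constructor
    · rintro rfl
      exact ⟨rfl, by simpa using hj⟩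
    · exact fun h => h.1

/-- Deleting from a rotation of `Π_m` the entries outside the range of `f` leaves the corresponding
rotation of `Π_n`. -/
theorem filterMap_partialInv_rotList {n m : ℕ} (f : Fin n ↪o Fin m) (v : LVertex n) :
    (rotList m (graphLEmbedding f v)).filterMap (Function.partialInv (graphLEmbedding f)) =
      rotList n v := by
  have hb : Function.partialInv (graphLEmbedding f) .b = some .b :=
    Function.partialInv_left (graphLEmbedding f).injective .b
  have hr : Function.partialInv (graphLEmbedding f) .r = some .r :=
    Function.partialInv_left (graphLEmbedding f).injective .r
  cases v with
  | b =>
    rw [graphLEmbedding_b, rotList, filterMap_partialInv_map_num, List.filterMap_reverse,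
      filterMap_partialInv_finRange, rotList]
  | r =>
    rw [graphLEmbedding_r, rotList, filterMap_partialInv_map_num, filterMap_partialInv_finRange,
      rotList]
  | num i =>
    rw [graphLEmbedding_num, rotList, List.filterMap_cons_some hb, List.filterMap_append,
      filterMap_partialInv_map_num, filterMap_partialInv_filter_ne, filterMap_partialInv_finRange,
      List.filterMap_cons_some hr, List.filterMap_nil, rotList]

theorem Drawing.Realizes.comap_graphLEmbedding {S : Type*} [TopologicalSpace S] [ChartedSpace ℂ S]
    {n m : ℕ} {D : Drawing (graphL m) S} (hD : D.Realizes (rotPi m)) (f : Fin n ↪o Fin m) :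
    (D.comap (graphLEmbedding f)).Realizes (rotPi n) := by
  intro v
  have h := Drawing.HasRotationAt.comap (hD (graphLEmbedding f v))
  rwa [filterMap_partialInv_rotList] at h

end SurfaceDrawing

theorem proposition2 (S : Type*) [TopologicalSpace S] [ChartedSpace ℂ S]
    [SurfaceDrawing.IsCompactOrientedSurface S]
    (hS : ∀ m : ℕ, 0 < m → ∃ D : SurfaceDrawing.Drawing (SurfaceDrawing.graphL m) S,
      D.IsSimple ∧ D.Realizes (SurfaceDrawing.rotPi m))
    (n : ℕ) (hn : 0 < n) :
    ∃ ℓ ∈ ({0, 1, 2} : Set ℕ), ∃ D : SurfaceDrawing.Drawing (SurfaceDrawing.graphL n) S,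
      SurfaceDrawing.IsEllDrawing ℓ D := by
  obtain ⟨N, hN⟩ := exists_monochromatic_orderEmbedding (Fin 3) n
  obtain ⟨D, hsimple, hrot⟩ := hS (N + 1) N.succ_pos
  have hcard : ∀ i j : Fin (N + 1), ∃ k : Fin 3, i ≠ j →
      (D.selfCrossings (SurfaceDrawing.canonicalCycle i j)).encard = (k : ℕ) := by
    intro i j
    by_cases hij : i = j
    · exact ⟨0, fun h => absurd hij h⟩
    · have hle := hsimple.encard_selfCrossings_canonicalCycle_le hij
      obtain ⟨k, hk⟩ := ENat.ne_top_iff_exists.1 (ne_top_of_le_ne_top (by decide) hle)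
      rw [← hk] at hle ⊢
      have : k ≤ 2 := by exact_mod_cast hle
      exact ⟨⟨k, by omega⟩, fun _ => rfl⟩
  choose c hc using hcard
  obtain ⟨f, ℓ, hf⟩ := hN (N + 1) N.le_succ c
  refine ⟨ℓ, ?_, D.comap (SurfaceDrawing.graphLEmbedding f), hsimple.comap _,
    hrot.comap_graphLEmbedding f, fun i j hij => ?_⟩
  · fin_cases ℓ <;> simp
  · rw [D.selfCrossings_comap, SurfaceDrawing.image_map_canonicalCycle]
    rcases lt_or_gt_of_ne hij with h | h
    · rw [hc _ _ (f.injective.ne hij), hf i j h]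
    · rw [SurfaceDrawing.canonicalCycle_comm, hc _ _ (f.injective.ne hij.symm), hf j i h]
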